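/- Let $d \ge 0$ be an integer and let $\omega$ be Lebesgue measure on $\mathbb{R}^d$. For positive locally finite Borel measures $\nu_1,\nu_2$ on $\mathbb{R}^d$, a transportation measure between $\nu_1$ and $\nu_2$ is a positive Borel measure $\gamma$ on $\mathbb{R}^d\times\mathbb{R}^d$ such that, for every continuous compactly supported $\varphi:\mathbb{R}^d\to\mathbb{R}$, the functions $(x,y)\mapsto\varphi(x)$ and $(x,y)\mapsto\varphi(y)$ are $\gamma$-integrable and $$\iint \varphi(x)\,d\gamma(x,y)=\int\varphi\,d\nu_1,\qquad \iint \varphi(y)\,d\gamma(x,y)=\int\varphi\,d\nu_2 .$$ The transportation distance is $$\mathrm{Tra}(\nu_1,\nu_2)=\inf_\gamma\,\sup\{|x-y| : (x,y)\in\operatorname{supp}\gamma\}\in[0,\infty],$$ where $|\cdot|$ is the Euclidean norm, $\operatorname{supp}\gamma$ is the closed support of $\gamma$, the infimum is over all transportation measures $\gamma$ between $\nu_1$ and $\nu_2$, and $\inf\emptyset=\infty$. For $z\in\mathbb{R}^d$ let $\nu^z$ be the shift of $\nu$ along $z$, that is, the image of $\nu$ under $x\mapsto x+z$. A positive locally finite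 measure $\nu$ on $\mathbb{R}^d$ is called uniformly spread over $\mathbb{R}^d$ if there is $\beta>0$ with $\mathrm{Tra}(\nu,\beta\omega)<\infty$. Theorem. A positive locally finite measure $\nu\not\equiv 0$ on $\mathbb{R}^d$ is uniformly spread over $\mathbb{R}^d$ if and only if there exists a constant $C_3<\infty$ such that $$\mathrm{Tra}(\nu,\nu^z)<C_3\qquad\text{for all } z\in\mathbb{R}^d .$$ -/

import Mathlib

open MeasureTheory
open scoped ENNReal NNReal

/-- A positive Borel measure `γ` on `ℝ^d × ℝ^d` is a transportation measure between `ν₁` and `ν₂`: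
integrating a continuous compactly supported function of the first (second) coordinate against `γ`
is the same as integrating it against `ν₁` (`ν₂`). The integrals against `γ` are required to exist;
for locally finite `ν₁`, `ν₂` those on the right-hand sides automatically do. -/
structure IsTransportationMeasure {d : ℕ}
    (γ : Measure (EuclideanSpace ℝ (Fin d) × EuclideanSpace ℝ (Fin d)))
    (ν₁ ν₂ : Measure (EuclideanSpace ℝ (Fin d))) : Prop where
  integrable_fst : ∀ φ : EuclideanSpace ℝ (Fin d) → ℝ, Continuous φ → HasCompactSupport φ →
    Integrable (fun p => φ p.1) γ
  integral_fst : ∀ φ : EuclideanSpace ℝ (Fin d) → ℝ, Continuous φ → HasCompactSupport φ →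
    ∫ p, φ p.1 ∂γ = ∫ x, φ x ∂ν₁
  integrable_snd : ∀ φ : EuclideanSpace ℝ (Fin d) → ℝ, Continuous φ → HasCompactSupport φ →
    Integrable (fun p => φ p.2) γ
  integral_snd : ∀ φ : EuclideanSpace ℝ (Fin d) → ℝ, Continuous φ → HasCompactSupport φ →
    ∫ p, φ p.2 ∂γ = ∫ y, φ y ∂ν₂

/-- The transportation distance: the infimum over all transportation measures `γ` of the supremum
of the Euclidean distance `|x - y|` over the (closed) support of `γ`. It is `∞` when there is no
transportation measure. -/
noncomputable def Tra {d : ℕ} (ν₁ ν₂ : Measure (EuclideanSpace ℝ (Fin d))) : ℝ≥0∞ :=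
  ⨅ (γ : Measure (EuclideanSpace ℝ (Fin d) × EuclideanSpace ℝ (Fin d)))
    (_ : IsTransportationMeasure γ ν₁ ν₂), ⨆ p ∈ γ.support, edist p.1 p.2

/-- The shift of `ν` along `z`, i.e. the image of `ν` under `x ↦ x + z`. -/
noncomputable def shiftMeasure {d : ℕ} (ν : Measure (EuclideanSpace ℝ (Fin d)))
    (z : EuclideanSpace ℝ (Fin d)) : Measure (EuclideanSpace ℝ (Fin d)) :=
  ν.map (fun x => x + z)

/-- `ν` is uniformly spread over `ℝ^d`: it is at finite transportation distance from a positive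
multiple of Lebesgue measure. -/
def IsUniformlySpread {d : ℕ} (ν : Measure (EuclideanSpace ℝ (Fin d))) : Prop :=
  ∃ β : ℝ≥0, 0 < β ∧ Tra ν (β • (volume : Measure (EuclideanSpace ℝ (Fin d)))) < ∞

/-! If `ν` is coupled with `βω` at bounded distance, translating the coupling along `z` couples
`ν^z` with the same `βω`, since `βω` is invariant. Gluing the two along `βω`
(`IsBoundedCoupling.exists_glue`) couples `ν` with `ν^z`, with a bound independent of `z`.

Conversely, take couplings `γ z` of `ν` with `ν^z` that move mass by at most `C`, and average them
over `z` with an invariant mean on the abelian group `ℝ^d` (`exists_isInvariantMean`). By Riesz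
representation the averaged integrals of test functions come from a measure `η`
(`IsInvariantMean.exists_isBoundedCoupling`). As displacements are bounded, no mass escapes: `η`
still has first marginal `ν` and moves mass by at most `C`. Its second marginal is the mean of all
`ν^z`, hence translation invariant, hence a multiple of `ω`; the multiple is nonzero because `ν ≠
0`. -/

open scoped Topology

/-! ### Invariant means on abelian groups -/

/-- Iterated Cesàro average of `g` along the vectors of a list, started at `x`. -/
noncomputable def cesaroAverage {G : Type*} [AddCommGroup G] (n : ℕ) :
    List G → (G → ℝ) → G → ℝ
  | [], g, x => g x
  | v :: l, g, x => (∑ k ∈ Finset.range n, cesaroAverage n l g (x + k • v)) / n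

namespace cesaroAverage

variable {G : Type*} [AddCommGroup G] {n : ℕ}

theorem add (l : List G) (g h : G → ℝ) (x : G) :
    cesaroAverage n l (g + h) x = cesaroAverage n l g x + cesaroAverage n l h x := by
  induction l generalizing x with
  | nil => simp [cesaroAverage]
  | cons v l ih => simp [cesaroAverage, ih, Finset.sum_add_distrib, add_div]

theorem smul (l : List G) (c : ℝ) (g : G → ℝ) (x : G) :
    cesaroAverage n l (c • g) x = c * cesaroAverage n l g x := by
  induction l generalizing x with
  | nil => simp [cesaroAverage]
  | cons v l ih => simp [cesaroAverage, ih, ← Finset.mul_sum, mul_div_assoc]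

theorem nonneg (l : List G) {g : G → ℝ} (hg : ∀ x, 0 ≤ g x) (x : G) :
    0 ≤ cesaroAverage n l g x := by
  induction l generalizing x with
  | nil => simpa [cesaroAverage] using hg x
  | cons v l ih =>
    simp only [cesaroAverage]
    exact div_nonneg (Finset.sum_nonneg fun k _ => ih _) (Nat.cast_nonneg n)

theorem const (hn : n ≠ 0) (l : List G) (c : ℝ) (x : G) :
    cesaroAverage n l (fun _ => c) x = c := by
  induction l generalizing x with
  | nil => simp [cesaroAverage]
  | cons v l ih => simp [cesaroAverage, ih, hn]

theorem abs_sum_div_le {f : ℕ → ℝ} {B : ℝ} (hB : 0 ≤ B) (hf : ∀ k, |f k| ≤ B) :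
    |(∑ k ∈ Finset.range n, f k) / n| ≤ B := by
  rw [abs_div, Nat.abs_cast]
  refine div_le_of_le_mul₀ (Nat.cast_nonneg n) hB ?_
  calc |∑ k ∈ Finset.range n, f k| ≤ ∑ k ∈ Finset.range n, |f k| := Finset.abs_sum_le_sum_abs _ _
    _ ≤ ∑ _k ∈ Finset.range n, B := Finset.sum_le_sum fun k _ => hf k
    _ = B * n := by simp [mul_comm]

theorem abs_le (l : List G) {g : G → ℝ} {B : ℝ} (hg : ∀ x, |g x| ≤ B) (x : G) :
    |cesaroAverage n l g x| ≤ B := by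
  induction l generalizing x with
  | nil => simpa [cesaroAverage] using hg x
  | cons v l ih =>
    simp only [cesaroAverage]
    exact abs_sum_div_le ((abs_nonneg _).trans (hg 0)) fun k => ih _

theorem comp_add_right (l : List G) (g : G → ℝ) (w x : G) :
    cesaroAverage n l (fun y => g (y + w)) x = cesaroAverage n l g (x + w) := by
  induction l generalizing x with
  | nil => simp [cesaroAverage]
  | cons v l ih => simp [cesaroAverage, ih, add_right_comm]

/-- The average along `v` itself telescopes to two boundary terms divided by `n`. Averaging further
along other vectors commutes with translation and does not increase the bound. -/
theorem abs_add_sub_le (l : List G) {g : G → ℝ} {B : ℝ} (hg : ∀ x, |g x| ≤ B) {v : G}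
    (hv : v ∈ l) (x : G) :
    |cesaroAverage n l g (x + v) - cesaroAverage n l g x| ≤ 2 * B / n := by
  have hB : 0 ≤ B := (abs_nonneg _).trans (hg 0)
  induction l generalizing x with
  | nil => simp at hv
  | cons w l ih =>
    simp only [cesaroAverage]
    rw [← sub_div, ← Finset.sum_sub_distrib]
    rcases List.mem_cons.1 hv with rfl | hv
    · have key : ∀ k : ℕ, x + v + k • v = x + (k + 1) • v := fun k => by
        rw [add_smul, one_smul, add_comm (k • v), add_assoc x v]
      simp only [key]
      rw [Finset.sum_range_sub (fun j : ℕ => cesaroAverage n l g (x + j • v)), abs_div,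
        Nat.abs_cast]
      gcongr
      refine (abs_sub _ _).trans ?_
      have h1 := abs_le (n := n) l hg (x + n • v)
      have h2 := abs_le (n := n) l hg (x + 0 • v)
      linarith
    · refine abs_sum_div_le (by positivity) fun k => ?_
      rw [add_right_comm]
      exact ih hv _

end cesaroAverage

/-- `m` is a translation-invariant mean on the bounded real functions on `G`. -/
structure IsInvariantMean {G : Type*} [AddCommGroup G] (m : (G → ℝ) → ℝ) : Prop where
  map_add : ∀ g h, (∃ B, ∀ x, |g x| ≤ B) → (∃ B, ∀ x, |h x| ≤ B) → m (g + h) = m g + m h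
  map_smul : ∀ (c : ℝ) g, (∃ B, ∀ x, |g x| ≤ B) → m (c • g) = c * m g
  map_nonneg : ∀ g, (∃ B, ∀ x, |g x| ≤ B) → (∀ x, 0 ≤ g x) → 0 ≤ m g
  map_const : ∀ c, m (fun _ => c) = c
  map_comp_add_right : ∀ g, (∃ B, ∀ x, |g x| ≤ B) → ∀ v, m (fun x => g (x + v)) = m g

/-- An abelian group carries an invariant mean on its bounded real functions. -/
theorem exists_isInvariantMean (G : Type*) [AddCommGroup G] :
    ∃ m : (G → ℝ) → ℝ, IsInvariantMean m := by
  classical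
  -- Along `U` the set of directions eventually contains any given vector and `n` tends to infinity,
  -- so the shift error `2 * B / n` vanishes.
  let U : Ultrafilter (Finset G × ℕ) := Ultrafilter.of Filter.atTop
  have hU : (U : Filter (Finset G × ℕ)) ≤ Filter.atTop := Ultrafilter.of_le _
  let A : (G → ℝ) → Finset G × ℕ → ℝ := fun g p => cesaroAverage p.2 p.1.toList g 0
  have hlim : ∀ g : G → ℝ, ∃ L : ℝ, (∃ B, ∀ x, |g x| ≤ B) → Filter.Tendsto (A g) U (𝓝 L) := by
    intro g
    by_cases hg : ∃ B, ∀ x, |g x| ≤ B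
    · obtain ⟨B, hB⟩ := hg
      obtain ⟨L, -, hL⟩ := (isCompact_Icc (a := -B) (b := B)).ultrafilter_le_nhds (U.map (A g)) (by
        rw [Filter.le_principal_iff]
        exact Filter.mem_map.2 (Filter.Eventually.of_forall fun p =>
          _root_.abs_le.1 (cesaroAverage.abs_le p.1.toList hB 0)))
      exact ⟨L, fun _ => hL⟩
    · exact ⟨0, fun h => absurd h hg⟩
  choose m hm using hlim
  refine ⟨m, ?_, ?_, ?_, ?_, ?_⟩
  · intro g h hg hh
    have hgh : ∃ B, ∀ x, |(g + h) x| ≤ B := by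
      obtain ⟨B, hB⟩ := hg
      obtain ⟨B', hB'⟩ := hh
      exact ⟨B + B', fun x => (abs_add_le _ _).trans (add_le_add (hB x) (hB' x))⟩
    refine tendsto_nhds_unique (hm _ hgh) (((hm g hg).add (hm h hh)).congr fun p => ?_)
    exact (cesaroAverage.add _ _ _ _).symm
  · intro c g hg
    have hcg : ∃ B, ∀ x, |(c • g) x| ≤ B := by
      obtain ⟨B, hB⟩ := hg
      refine ⟨|c| * B, fun x => ?_⟩
      rw [Pi.smul_apply, smul_eq_mul, abs_mul]
      exact mul_le_mul_of_nonneg_left (hB x) (abs_nonneg c)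
    refine tendsto_nhds_unique (hm _ hcg) (((hm g hg).const_mul c).congr fun p => ?_)
    exact (cesaroAverage.smul _ _ _ _).symm
  · intro g hg h0
    exact ge_of_tendsto' (hm g hg) fun p => cesaroAverage.nonneg _ h0 _
  · intro c
    refine tendsto_nhds_unique (hm _ ⟨|c|, fun _ => le_rfl⟩) (tendsto_const_nhds.congr' ?_)
    -- `n = 0` must be excluded: division by zero would make a nonempty average `0`.
    filter_upwards [hU (Filter.eventually_ge_atTop (∅, 1))] with p hp
    exact (cesaroAverage.const (by have := hp.2; simp only at this; omega) _ _ _).symm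
  · intro g hg v
    obtain ⟨B, hB⟩ := hg
    have h0 : Filter.Tendsto (fun p => A (fun x => g (x + v)) p - A g p) U (𝓝 0) := by
      have hB0 : Filter.Tendsto (fun p : Finset G × ℕ => 2 * B / (p.2 : ℝ)) U (𝓝 0) := by
        have : Filter.Tendsto (fun p : Finset G × ℕ => p.2) U Filter.atTop := by
          refine Filter.Tendsto.mono_left ?_ hU
          rw [← Filter.prod_atTop_atTop_eq]
          exact Filter.tendsto_snd
        exact (tendsto_const_div_atTop_nhds_zero_nat (2 * B)).comp this
      refine squeeze_zero_norm' ?_ hB0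
      filter_upwards [hU (Filter.eventually_ge_atTop ({v}, 0))] with p hp
      rw [Real.norm_eq_abs]
      simp only [A]
      rw [cesaroAverage.comp_add_right]
      exact cesaroAverage.abs_add_sub_le _ hB (by simpa using hp.1) 0
    have h1 := (hm _ ⟨B, fun x => hB (x + v)⟩).sub (hm g ⟨B, hB⟩)
    exact sub_eq_zero.1 (tendsto_nhds_unique h1 h0)

/-! ### Measures determined by test functions -/

section Bump

variable {X : Type*} [MetricSpace X] [ProperSpace X]

/-- Compactly supported Urysohn function of a compact set. -/
theorem IsCompact.exists_compactlySupported_eq_one {K : Set X} (hK : IsCompact K) :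
    ∃ χ : X → ℝ, Continuous χ ∧ HasCompactSupport χ ∧ (∀ x ∈ K, χ x = 1) ∧
      ∀ x, 0 ≤ χ x ∧ χ x ≤ 1 := by
  obtain ⟨f, h1, -, h2, h3⟩ := exists_continuous_one_zero_of_isCompact hK isClosed_empty
    (Set.disjoint_empty K)
  exact ⟨f, f.continuous, h2, h1, fun x => ⟨(h3 x).1, (h3 x).2⟩⟩

variable [MeasurableSpace X]

/-- A measure integrating all compactly supported continuous functions is finite on compacts. -/
theorem isFiniteMeasureOnCompacts_of_integrable {μ : Measure X}
    (h : ∀ φ : X → ℝ, Continuous φ → HasCompactSupport φ → Integrable φ μ) :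
    IsFiniteMeasureOnCompacts μ := by
  refine ⟨fun K hK => ?_⟩
  obtain ⟨χ, hc, hs, h1, -⟩ := hK.exists_compactlySupported_eq_one
  refine lt_of_le_of_lt (measure_mono fun x hx => ?_)
    ((h χ hc hs).measure_norm_ge_lt_top one_pos)
  simp [h1 x hx]

variable [BorelSpace X]

theorem ext_of_integral_eq_of_hasCompactSupport {μ ν : Measure X} [IsFiniteMeasureOnCompacts μ]
    [IsFiniteMeasureOnCompacts ν]
    (h : ∀ φ : X → ℝ, Continuous φ → HasCompactSupport φ → ∫ x, φ x ∂μ = ∫ x, φ x ∂ν) :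
    μ = ν :=
  Measure.ext_of_integral_eq_on_compactlySupported fun f => h f f.continuous f.hasCompactSupport

/-- A pushforward with the same integrals of test functions as `ν` equals `ν`. -/
theorem map_eq_of_integral_eq {Ω : Type*} [MeasurableSpace Ω] {γ : Measure Ω} {f : Ω → X}
    (hf : Measurable f) {ν : Measure X} [IsFiniteMeasureOnCompacts ν]
    (hi : ∀ φ : X → ℝ, Continuous φ → HasCompactSupport φ → Integrable (fun p => φ (f p)) γ)
    (he : ∀ φ : X → ℝ, Continuous φ → HasCompactSupport φ → ∫ p, φ (f p) ∂γ = ∫ x, φ x ∂ν) :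
    γ.map f = ν := by
  have : IsFiniteMeasureOnCompacts (γ.map f) :=
    isFiniteMeasureOnCompacts_of_integrable fun φ hc hs =>
      (integrable_map_measure hc.aestronglyMeasurable hf.aemeasurable).2 (hi φ hc hs)
  refine ext_of_integral_eq_of_hasCompactSupport fun φ hc hs => ?_
  rw [integral_map hf.aemeasurable hc.aestronglyMeasurable, he φ hc hs]

end Bump

/-! ### Bounded couplings and the transportation distance -/

/-- `γ` couples `μ` with `ν` and moves mass by at most `C`. -/
structure IsBoundedCoupling {X : Type*} [PseudoEMetricSpace X] [MeasurableSpace X]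
    (γ : Measure (X × X)) (μ ν : Measure X) (C : ℝ≥0∞) : Prop where
  map_fst : γ.map Prod.fst = μ
  map_snd : γ.map Prod.snd = ν
  ae_edist_le : ∀ᵐ p ∂γ, edist p.1 p.2 ≤ C

theorem IsBoundedCoupling.mono {X : Type*} [PseudoEMetricSpace X] [MeasurableSpace X]
    {γ : Measure (X × X)} {μ ν : Measure X} {C D : ℝ≥0∞} (h : IsBoundedCoupling γ μ ν C)
    (hCD : C ≤ D) : IsBoundedCoupling γ μ ν D :=
  ⟨h.map_fst, h.map_snd, h.ae_edist_le.mono fun _ hp => hp.trans hCD⟩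

theorem IsBoundedCoupling.integral_comp_fst {X : Type*} [PseudoEMetricSpace X] [MeasurableSpace X]
    [OpensMeasurableSpace X] {γ : Measure (X × X)} {μ ν : Measure X} {C : ℝ≥0∞}
    (h : IsBoundedCoupling γ μ ν C) {φ : X → ℝ} (hc : Continuous φ) :
    ∫ p, φ p.1 ∂γ = ∫ x, φ x ∂μ := by
  rw [← h.map_fst, integral_map measurable_fst.aemeasurable hc.aestronglyMeasurable]

theorem IsBoundedCoupling.integral_comp_snd {X : Type*} [PseudoEMetricSpace X] [MeasurableSpace X]
    [OpensMeasurableSpace X] {γ : Measure (X × X)} {μ ν : Measure X} {C : ℝ≥0∞}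
    (h : IsBoundedCoupling γ μ ν C) {φ : X → ℝ} (hc : Continuous φ) :
    ∫ p, φ p.2 ∂γ = ∫ x, φ x ∂ν := by
  rw [← h.map_snd, integral_map measurable_snd.aemeasurable hc.aestronglyMeasurable]

section Transportation

variable {d : ℕ} {γ : Measure (EuclideanSpace ℝ (Fin d) × EuclideanSpace ℝ (Fin d))}
  {μ ν : Measure (EuclideanSpace ℝ (Fin d))} [IsLocallyFiniteMeasure μ] [IsLocallyFiniteMeasure ν]

theorem IsTransportationMeasure.isBoundedCoupling (h : IsTransportationMeasure γ μ ν) :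
    IsBoundedCoupling γ μ ν (⨆ p ∈ γ.support, edist p.1 p.2) where
  map_fst := map_eq_of_integral_eq measurable_fst h.integrable_fst h.integral_fst
  map_snd := map_eq_of_integral_eq measurable_snd h.integrable_snd h.integral_snd
  ae_edist_le := by
    filter_upwards [Measure.support_mem_ae (μ := γ)] with p hp
    exact le_iSup₂ (f := fun (p : EuclideanSpace ℝ (Fin d) × EuclideanSpace ℝ (Fin d))
      (_ : p ∈ γ.support) => edist p.1 p.2) p hp

theorem IsBoundedCoupling.isTransportationMeasure {C : ℝ≥0∞} (h : IsBoundedCoupling γ μ ν C) :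
    IsTransportationMeasure γ μ ν where
  integrable_fst φ hc hs := by
    have := hc.integrable_of_hasCompactSupport (μ := μ) hs
    rw [← h.map_fst] at this
    exact this.comp_measurable measurable_fst
  integral_fst φ hc _ := h.integral_comp_fst hc
  integrable_snd φ hc hs := by
    have := hc.integrable_of_hasCompactSupport (μ := ν) hs
    rw [← h.map_snd] at this
    exact this.comp_measurable measurable_snd
  integral_snd φ hc _ := h.integral_comp_snd hc

/-- The set `edist p.1 p.2 ≤ C` is closed, so an almost everywhere bound holds on the whole support.
-/
theorem IsBoundedCoupling.tra_le {C : ℝ≥0∞} (h : IsBoundedCoupling γ μ ν C) : Tra μ ν ≤ C := by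
  refine (iInf₂_le γ h.isTransportationMeasure).trans (iSup₂_le fun p hp => ?_)
  have hcl : IsClosed {p : EuclideanSpace ℝ (Fin d) × EuclideanSpace ℝ (Fin d) |
      edist p.1 p.2 ≤ C} := isClosed_le (by fun_prop) continuous_const
  exact Measure.support_subset_of_isClosed hcl h.ae_edist_le hp

theorem exists_isBoundedCoupling_of_tra_lt {C : ℝ≥0∞} (h : Tra μ ν < C) :
    ∃ γ, ∃ D < C, IsBoundedCoupling γ μ ν D := by
  obtain ⟨γ, h⟩ := iInf_lt_iff.1 h
  obtain ⟨hγ, h⟩ := iInf_lt_iff.1 h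
  exact ⟨γ, _, h, hγ.isBoundedCoupling⟩

end Transportation

/-! ### Gluing couplings -/

section Gluing

variable {X : Type*} [MetricSpace X] [MeasurableSpace X]

/-- A separable metric space is a countable disjoint union of measurable sets of radius one. -/
theorem exists_measurable_partition_subset_closedBall [OpensMeasurableSpace X]
    [SecondCountableTopology X] [Nonempty X] :
    ∃ (s : ℕ → Set X) (a : ℕ → X), (∀ i, MeasurableSet (s i)) ∧
      Pairwise (Function.onFun Disjoint s) ∧ (⋃ i, s i) = Set.univ ∧
      ∀ i, s i ⊆ Metric.closedBall (a i) 1 := by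
  refine ⟨disjointed fun i => Metric.closedBall (TopologicalSpace.denseSeq X i) 1,
    TopologicalSpace.denseSeq X, fun i => MeasurableSet.disjointed
      (fun j => measurableSet_closedBall) i, disjoint_disjointed _, ?_, fun i => disjointed_le _ i⟩
  rw [iUnion_disjointed, Set.eq_univ_iff_forall]
  intro x
  obtain ⟨i, hi⟩ := (TopologicalSpace.denseRange_denseSeq X).exists_dist_lt x one_pos
  exact Set.mem_iUnion.2 ⟨i, Metric.mem_closedBall.2 hi.le⟩

/-- The part of the first marginal of `γ` that is sent into `s`. -/
noncomputable def sentInto (γ : Measure (X × X)) (s : Set X) : Measure X :=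
  (γ.restrict (Prod.snd ⁻¹' s)).map Prod.fst

theorem sentInto_univ {γ : Measure (X × X)} {μ ρ : Measure X} {C : ℝ≥0∞}
    (h : IsBoundedCoupling γ μ ρ C) {s : Set X} (hs : MeasurableSet s) :
    sentInto γ s Set.univ = ρ s := by
  rw [sentInto, Measure.map_apply measurable_fst MeasurableSet.univ, Set.preimage_univ,
    Measure.restrict_apply_univ, ← h.map_snd, Measure.map_apply measurable_snd hs]

theorem sum_sentInto {γ : Measure (X × X)} {μ ρ : Measure X} {C : ℝ≥0∞}
    (h : IsBoundedCoupling γ μ ρ C) {s : ℕ → Set X} (hs : ∀ i, MeasurableSet (s i))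
    (hd : Pairwise (Function.onFun Disjoint s)) (hu : (⋃ i, s i) = Set.univ) :
    Measure.sum (fun i => sentInto γ (s i)) = μ := by
  have hd' : Pairwise (Function.onFun Disjoint fun i => (Prod.snd ⁻¹' s i : Set (X × X))) :=
    fun i j hij => (hd hij).preimage _
  simp only [sentInto]
  rw [← Measure.map_sum measurable_fst.aemeasurable,
    ← Measure.restrict_iUnion hd' fun i => measurable_snd (hs i), ← Set.preimage_iUnion, hu,
    Set.preimage_univ, Measure.restrict_univ, h.map_fst]

theorem ae_sentInto_edist_le [BorelSpace X] {γ : Measure (X × X)} {μ ρ : Measure X} {C : ℝ≥0∞}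
    (h : IsBoundedCoupling γ μ ρ C) {s : Set X} (hs : MeasurableSet s) {a : X}
    (ha : s ⊆ Metric.closedBall a 1) :
    ∀ᵐ x ∂sentInto γ s, edist x a ≤ C + 1 := by
  rw [sentInto, ae_map_iff measurable_fst.aemeasurable
    (measurableSet_le (by fun_prop) measurable_const)]
  filter_upwards [ae_restrict_of_ae h.ae_edist_le, ae_restrict_mem (measurable_snd hs)] with p h1 h2
  refine (edist_triangle p.1 p.2 a).trans (add_le_add h1 ?_)
  rw [edist_dist, ← ENNReal.ofReal_one]
  exact ENNReal.ofReal_le_ofReal (ha h2)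

/-- Couplings of `μ` and `ν` with a common measure can be glued, losing a bounded amount. -/
theorem IsBoundedCoupling.exists_glue [BorelSpace X] [ProperSpace X] [Nonempty X]
    {γ γ' : Measure (X × X)} {μ ν ρ : Measure X} [IsFiniteMeasureOnCompacts ρ] {C D : ℝ≥0∞}
    (h : IsBoundedCoupling γ μ ρ C) (h' : IsBoundedCoupling γ' ν ρ D) :
    ∃ η, IsBoundedCoupling η μ ν (C + 1 + (D + 1)) := by
  obtain ⟨s, a, hs, hd, hu, ha⟩ := exists_measurable_partition_subset_closedBall (X := X)
  have hρ : ∀ i, ρ (s i) ≠ ∞ := fun i =>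
    ((measure_mono (ha i)).trans_lt (isCompact_closedBall (a i) 1).measure_lt_top).ne
  have hfin : ∀ i, IsFiniteMeasure (sentInto γ (s i)) := fun i =>
    ⟨by rw [sentInto_univ h (hs i)]; exact (hρ i).lt_top⟩
  have hfin' : ∀ i, IsFiniteMeasure (sentInto γ' (s i)) := fun i =>
    ⟨by rw [sentInto_univ h' (hs i)]; exact (hρ i).lt_top⟩
  -- For a null piece the inverse is `∞`, but `τ` then vanishes as well.
  have hscale : ∀ i (τ : Measure X), τ Set.univ = ρ (s i) → (ρ (s i))⁻¹ • ρ (s i) • τ = τ := by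
    intro i τ hτ
    rcases eq_or_ne (ρ (s i)) 0 with h0 | h0
    · rw [h0, Measure.measure_univ_eq_zero] at hτ
      simp [hτ]
    · rw [smul_smul, ENNReal.inv_mul_cancel h0 (hρ i), one_smul]
  -- The masses that `γ` and `γ'` send into `s i` both total `ρ (s i)`, so their normalized product
  -- couples them. They lie within `C + 1` and `D + 1` of `a i`, so any pairing will do.
  refine ⟨Measure.sum fun i => (ρ (s i))⁻¹ • (sentInto γ (s i)).prod (sentInto γ' (s i)), ?_, ?_, ?_⟩
  · rw [Measure.map_sum measurable_fst.aemeasurable, ← sum_sentInto h hs hd hu]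
    congr 1 with i : 1
    rw [Measure.map_smul, Measure.map_fst_prod, sentInto_univ h' (hs i)]
    exact hscale i _ (sentInto_univ h (hs i))
  · rw [Measure.map_sum measurable_snd.aemeasurable, ← sum_sentInto h' hs hd hu]
    congr 1 with i : 1
    rw [Measure.map_smul, Measure.map_snd_prod, sentInto_univ h (hs i)]
    exact hscale i _ (sentInto_univ h' (hs i))
  · refine Measure.ae_sum_iff.2 fun i => Measure.ae_smul_measure ?_ _
    filter_upwards [Measure.quasiMeasurePreserving_fst.ae (ae_sentInto_edist_le h (hs i) (ha i)),
      Measure.quasiMeasurePreserving_snd.ae (ae_sentInto_edist_le h' (hs i) (ha i))] with p h1 h2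
    refine (edist_triangle_right p.1 p.2 (a i)).trans (add_le_add h1 h2)

end Gluing

/-! ### Shifts and the direct implication -/

section Shift

variable {d : ℕ} {μ : Measure (EuclideanSpace ℝ (Fin d))}

instance isLocallyFiniteMeasure_shiftMeasure [IsLocallyFiniteMeasure μ]
    (z : EuclideanSpace ℝ (Fin d)) : IsLocallyFiniteMeasure (shiftMeasure μ z) :=
  have : IsFiniteMeasureOnCompacts (shiftMeasure μ z) :=
    Measure.IsFiniteMeasureOnCompacts.map μ (Homeomorph.addRight z)
  inferInstance

theorem shiftMeasure_smul_volume (c : ℝ≥0) (z : EuclideanSpace ℝ (Fin d)) :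
    shiftMeasure (c • (volume : Measure (EuclideanSpace ℝ (Fin d)))) z = c • volume := by
  rw [shiftMeasure, Measure.map_smul, map_add_right_eq_self]

theorem IsBoundedCoupling.shift {γ : Measure (EuclideanSpace ℝ (Fin d) × EuclideanSpace ℝ (Fin d))}
    {ν : Measure (EuclideanSpace ℝ (Fin d))} {C : ℝ≥0∞} (h : IsBoundedCoupling γ μ ν C)
    (z : EuclideanSpace ℝ (Fin d)) :
    IsBoundedCoupling (γ.map fun p => (p.1 + z, p.2 + z)) (shiftMeasure μ z) (shiftMeasure ν z)
      C := by
  have hz : Measurable fun p : EuclideanSpace ℝ (Fin d) × EuclideanSpace ℝ (Fin d) =>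
      (p.1 + z, p.2 + z) := by fun_prop
  have hz' : Measurable fun x : EuclideanSpace ℝ (Fin d) => x + z := by fun_prop
  refine ⟨?_, ?_, ?_⟩
  · rw [shiftMeasure, ← h.map_fst, Measure.map_map measurable_fst hz,
      Measure.map_map hz' measurable_fst]
    rfl
  · rw [shiftMeasure, ← h.map_snd, Measure.map_map measurable_snd hz,
      Measure.map_map hz' measurable_snd]
    rfl
  · rw [ae_map_iff hz.aemeasurable (measurableSet_le (by fun_prop) measurable_const)]
    simpa using h.ae_edist_le

end Shift

theorem IsUniformlySpread.exists_tra_shiftMeasure_lt {d : ℕ}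
    {ν : Measure (EuclideanSpace ℝ (Fin d))} [IsLocallyFiniteMeasure ν]
    (h : IsUniformlySpread ν) :
    ∃ C : ℝ≥0, ∀ z : EuclideanSpace ℝ (Fin d), Tra ν (shiftMeasure ν z) < (C : ℝ≥0∞) := by
  obtain ⟨β, -, hβ⟩ := h
  obtain ⟨γ, D, hD, hγ⟩ := exists_isBoundedCoupling_of_tra_lt hβ
  lift D to ℝ≥0 using hD.ne
  -- Gluing gives `D + 1 + (D + 1)`; the last `1` makes the inequality strict.
  refine ⟨D + 1 + (D + 1) + 1, fun z => ?_⟩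
  have hz := hγ.shift z
  rw [shiftMeasure_smul_volume] at hz
  obtain ⟨η, hη⟩ := hγ.exists_glue hz
  refine hη.tra_le.trans_lt ?_
  norm_cast
  simp

/-! ### Means of couplings -/

section Limit

variable {X : Type*} [MetricSpace X] [ProperSpace X]

/-- A test function on the product is dominated by a test function of the first coordinate. -/
theorem HasCompactSupport.exists_norm_le_comp_fst {f : X × X → ℝ} (hc : Continuous f)
    (hs : HasCompactSupport f) :
    ∃ ψ : X → ℝ, Continuous ψ ∧ HasCompactSupport ψ ∧ ∀ p, ‖f p‖ ≤ ψ p.1 := by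
  obtain ⟨M, hM⟩ := hc.bounded_above_of_compact_support hs
  obtain ⟨χ, hχc, hχs, h1, h01⟩ :=
    (hs.isCompact.image continuous_fst).exists_compactlySupported_eq_one
  have hM0 : 0 ≤ |M| := abs_nonneg M
  refine ⟨fun x => |M| * χ x, by fun_prop, hχs.mul_left, fun p => ?_⟩
  beta_reduce
  by_cases hp : p ∈ tsupport f
  · rw [h1 _ (Set.mem_image_of_mem _ hp), mul_one]
    exact (hM p).trans (le_abs_self M)
  · rw [image_eq_zero_of_notMem_tsupport hp, norm_zero]
    exact mul_nonneg hM0 (h01 _).1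

/-- Near the diagonal, a test function of the first coordinate is a test function on the
product. -/
theorem HasCompactSupport.exists_eq_comp_fst {φ : X → ℝ} (hc : Continuous φ)
    (hs : HasCompactSupport φ) (C : ℝ≥0) :
    ∃ f : X × X → ℝ, Continuous f ∧ HasCompactSupport f ∧
      ∀ p : X × X, edist p.1 p.2 ≤ C → f p = φ p.1 := by
  obtain ⟨χ, hχc, hχs, h1, -⟩ :=
    (hs.isCompact.cthickening (r := (C : ℝ))).exists_compactlySupported_eq_one
  -- `χ` is `1` on the closed `C`-neighbourhood of the support of `φ`, where `p.2` must lie if `p.1`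
  -- is in that support.
  refine ⟨fun p => φ p.1 * χ p.2, by fun_prop,
    HasCompactSupport.intro (hs.isCompact.prod hχs.isCompact) fun p hp => ?_,
    fun p hp => ?_⟩ <;> beta_reduce
  · by_cases h : p.1 ∈ tsupport φ
    · rw [image_eq_zero_of_notMem_tsupport fun h' => hp ⟨h, h'⟩, mul_zero]
    · rw [image_eq_zero_of_notMem_tsupport h, zero_mul]
  · by_cases h : p.1 ∈ tsupport φ
    · rw [h1, mul_one]
      refine Metric.mem_cthickening_of_dist_le _ _ _ _ h ?_
      rw [dist_comm]
      rw [edist_nndist] at hp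
      exact_mod_cast hp
    · rw [image_eq_zero_of_notMem_tsupport h, zero_mul]

theorem HasCompactSupport.exists_eq_comp_snd {φ : X → ℝ} (hc : Continuous φ)
    (hs : HasCompactSupport φ) (C : ℝ≥0) :
    ∃ f : X × X → ℝ, Continuous f ∧ HasCompactSupport f ∧
      ∀ p : X × X, edist p.1 p.2 ≤ C → f p = φ p.2 := by
  obtain ⟨f, hfc, hfs, hf⟩ := hs.exists_eq_comp_fst hc C
  refine ⟨f ∘ Prod.swap, hfc.comp continuous_swap,
    hfs.comp_homeomorph (Homeomorph.prodComm X X), fun p hp => hf p.swap ?_⟩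
  rwa [Prod.fst_swap, Prod.snd_swap, edist_comm]

variable [MeasurableSpace X] [BorelSpace X]

theorem IsBoundedCoupling.integrable_of_hasCompactSupport {γ : Measure (X × X)} {μ ν : Measure X}
    [IsFiniteMeasureOnCompacts μ] {C : ℝ≥0∞} (h : IsBoundedCoupling γ μ ν C) {f : X × X → ℝ}
    (hc : Continuous f) (hs : HasCompactSupport f) : Integrable f γ := by
  obtain ⟨ψ, hψc, hψs, hψ⟩ := hs.exists_norm_le_comp_fst hc
  have hi := hψc.integrable_of_hasCompactSupport (μ := μ) hψs
  rw [← h.map_fst] at hi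
  exact (hi.comp_measurable measurable_fst).mono' hc.aestronglyMeasurable (.of_forall hψ)

/-- All `γ z` share the first marginal `μ`, so a dominating function of the first coordinate has the
same integral for every `z`. This makes the mean applicable. -/
theorem exists_abs_integral_le_of_isBoundedCoupling {ι : Type*} {γ : ι → Measure (X × X)}
    {μ : Measure X} {ν : ι → Measure X} [IsFiniteMeasureOnCompacts μ] {C : ℝ≥0∞}
    (h : ∀ z, IsBoundedCoupling (γ z) μ (ν z) C) {f : X × X → ℝ}
    (hc : Continuous f) (hs : HasCompactSupport f) : ∃ B, ∀ z, |∫ p, f p ∂γ z| ≤ B := by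
  obtain ⟨ψ, hψc, hψs, hψ⟩ := hs.exists_norm_le_comp_fst hc
  refine ⟨∫ x, ψ x ∂μ, fun z => ?_⟩
  have hi := hψc.integrable_of_hasCompactSupport (μ := μ) hψs
  rw [← (h z).map_fst] at hi ⊢
  rw [integral_map measurable_fst.aemeasurable hψc.aestronglyMeasurable, ← Real.norm_eq_abs]
  exact norm_integral_le_of_norm_le (hi.comp_measurable measurable_fst) (.of_forall hψ)

open scoped CompactlySupported in
/-- The mean of the integrals against a family of couplings of `μ`, as a positive functional. -/
noncomputable def meanIntegral {G : Type*} [AddCommGroup G] {m : (G → ℝ) → ℝ}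
    (hm : IsInvariantMean m) {γ : G → Measure (X × X)} {μ : Measure X} {ν : G → Measure X}
    [IsFiniteMeasureOnCompacts μ] {C : ℝ≥0∞} (h : ∀ z, IsBoundedCoupling (γ z) μ (ν z) C) :
    C_c(X × X, ℝ) →ₚ[ℝ] ℝ :=
  PositiveLinearMap.mk₀
    { toFun := fun f => m fun z => ∫ p, f p ∂γ z
      map_add' := fun f g => by
        rw [← hm.map_add _ _
          (exists_abs_integral_le_of_isBoundedCoupling h (f := f) f.continuous f.hasCompactSupport)
          (exists_abs_integral_le_of_isBoundedCoupling h (f := g) g.continuous g.hasCompactSupport)]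
        congr 1 with z
        exact integral_add ((h z).integrable_of_hasCompactSupport f.continuous f.hasCompactSupport)
          ((h z).integrable_of_hasCompactSupport g.continuous g.hasCompactSupport)
      map_smul' := fun c f => by
        rw [RingHom.id_apply, smul_eq_mul, ← hm.map_smul _ _
          (exists_abs_integral_le_of_isBoundedCoupling h (f := f) f.continuous f.hasCompactSupport)]
        congr 1 with z
        exact integral_const_mul c _ }
    fun f hf => hm.map_nonneg _
      (exists_abs_integral_le_of_isBoundedCoupling h (f := f) f.continuous f.hasCompactSupport)
      fun _ => integral_nonneg hf

/-- A mean of couplings of `μ` with `ν z` is a coupling of `μ` with the mean of the `ν z`. -/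
theorem IsInvariantMean.exists_isBoundedCoupling {G : Type*} [AddCommGroup G] {m : (G → ℝ) → ℝ}
    (hm : IsInvariantMean m) {γ : G → Measure (X × X)} {μ : Measure X} {ν : G → Measure X}
    [IsFiniteMeasureOnCompacts μ] {C : ℝ≥0} (h : ∀ z, IsBoundedCoupling (γ z) μ (ν z) C) :
    ∃ (η : Measure (X × X)) (ρ : Measure X), IsBoundedCoupling η μ ρ C ∧
      IsFiniteMeasureOnCompacts ρ ∧ ∀ φ : X → ℝ, Continuous φ → HasCompactSupport φ →
        (∃ B, ∀ z, |∫ x, φ x ∂ν z| ≤ B) ∧ ∫ x, φ x ∂ρ = m fun z => ∫ x, φ x ∂ν z := by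
  set η := RealRMK.rieszMeasure (meanIntegral hm h) with hη
  have hint : ∀ f : X × X → ℝ, Continuous f → HasCompactSupport f →
      ∫ p, f p ∂η = m fun z => ∫ p, f p ∂γ z := fun f hc hs =>
    RealRMK.integral_rieszMeasure (meanIntegral hm h) ⟨⟨f, hc⟩, hs⟩
  -- The set of larger displacements is open. A test function supported in it integrates to `0`
  -- against every `γ z`, so each compact subset is `η`-null.
  have hae : ∀ᵐ p ∂η, edist p.1 p.2 ≤ C := by
    have hU : IsOpen {p : X × X | (C : ℝ≥0∞) < edist p.1 p.2} :=
      isOpen_lt continuous_const (by fun_prop)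
    rw [ae_iff]
    simp only [not_le]
    rw [hU.measure_eq_iSup_isCompact]
    simp only [ENNReal.iSup_eq_zero]
    intro K hKU hK
    obtain ⟨f, h1, h0, hs, h01⟩ := exists_continuous_one_zero_of_isCompact hK hU.isClosed_compl
      (Set.disjoint_compl_right_iff_subset.2 hKU)
    have hle := RealRMK.rieszMeasure_le_of_eq_one (meanIntegral hm h) (f := ⟨f, hs⟩)
      (fun p => (h01 p).1) hK (fun p hp => h1 hp)
    have hz : meanIntegral hm h ⟨f, hs⟩ = 0 := by
      have : (fun z => ∫ p, f p ∂γ z) = fun _ => (0 : ℝ) := by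
        funext z
        refine integral_eq_zero_of_ae ?_
        filter_upwards [(h z).ae_edist_le] with p hp
        exact h0 (not_lt.2 hp)
      change (m fun z => ∫ p, f p ∂γ z) = 0
      rw [this, hm.map_const]
    rw [hz, ENNReal.ofReal_zero] at hle
    exact le_antisymm hle zero_le
  -- `g` need not have compact support: it agrees with `f` almost everywhere for `η` and every `γ
  -- z`. This yields the marginals of `η`.
  have key : ∀ (f g : X × X → ℝ), Continuous f → HasCompactSupport f →
      (∀ p : X × X, edist p.1 p.2 ≤ C → f p = g p) →
      Integrable g η ∧ (∃ B, ∀ z, |∫ p, g p ∂γ z| ≤ B) ∧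
        ∫ p, g p ∂η = m fun z => ∫ p, g p ∂γ z := by
    intro f g hc hs hfg
    have e1 : f =ᵐ[η] g := hae.mono hfg
    have e2 : ∀ z, ∫ p, g p ∂γ z = ∫ p, f p ∂γ z := fun z =>
      (integral_congr_ae ((h z).ae_edist_le.mono hfg)).symm
    simp only [e2]
    exact ⟨(hc.integrable_of_hasCompactSupport hs).congr e1,
      exists_abs_integral_le_of_isBoundedCoupling h hc hs,
      (integral_congr_ae e1).symm.trans (hint f hc hs)⟩
  have hfst : ∀ φ : X → ℝ, Continuous φ → HasCompactSupport φ →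
      Integrable (fun p => φ p.1) η ∧ ∫ p, φ p.1 ∂η = ∫ x, φ x ∂μ := by
    intro φ hc hs
    obtain ⟨f, hfc, hfs, hf⟩ := hs.exists_eq_comp_fst hc C
    obtain ⟨hi, -, he⟩ := key f (fun p => φ p.1) hfc hfs hf
    simp only [(h _).integral_comp_fst hc, hm.map_const] at he
    exact ⟨hi, he⟩
  have hsnd : ∀ φ : X → ℝ, Continuous φ → HasCompactSupport φ →
      Integrable (fun p => φ p.2) η ∧ (∃ B, ∀ z, |∫ x, φ x ∂ν z| ≤ B) ∧
        ∫ p, φ p.2 ∂η = m fun z => ∫ x, φ x ∂ν z := by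
    intro φ hc hs
    obtain ⟨f, hfc, hfs, hf⟩ := hs.exists_eq_comp_snd hc C
    have := key f (fun p => φ p.2) hfc hfs hf
    simpa only [(h _).integral_comp_snd hc] using this
  refine ⟨η, η.map Prod.snd, ⟨?_, rfl, hae⟩, ?_, fun φ hc hs => ⟨(hsnd φ hc hs).2.1, ?_⟩⟩
  · exact map_eq_of_integral_eq measurable_fst (fun φ hc hs => (hfst φ hc hs).1)
      fun φ hc hs => (hfst φ hc hs).2
  · exact isFiniteMeasureOnCompacts_of_integrable fun φ hc hs =>
      (integrable_map_measure hc.aestronglyMeasurable measurable_snd.aemeasurable).2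
        (hsnd φ hc hs).1
  · rw [integral_map measurable_snd.aemeasurable hc.aestronglyMeasurable]
    exact (hsnd φ hc hs).2.2

end Limit

/-! ### The converse and the equivalence -/

theorem integral_shiftMeasure {d : ℕ} (ν : Measure (EuclideanSpace ℝ (Fin d)))
    (z : EuclideanSpace ℝ (Fin d)) {φ : EuclideanSpace ℝ (Fin d) → ℝ} (hc : Continuous φ) :
    ∫ x, φ x ∂shiftMeasure ν z = ∫ x, φ (x + z) ∂ν := by
  rw [shiftMeasure, integral_map (by fun_prop) hc.aestronglyMeasurable]

theorem isUniformlySpread_of_tra_shiftMeasure_lt {d : ℕ}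
    {ν : Measure (EuclideanSpace ℝ (Fin d))} [IsLocallyFiniteMeasure ν] (hν : ν ≠ 0) {C : ℝ≥0}
    (h : ∀ z : EuclideanSpace ℝ (Fin d), Tra ν (shiftMeasure ν z) < (C : ℝ≥0∞)) :
    IsUniformlySpread ν := by
  obtain ⟨m, hm⟩ := exists_isInvariantMean (EuclideanSpace ℝ (Fin d))
  choose γ D hD hγ using fun z => exists_isBoundedCoupling_of_tra_lt (h z)
  obtain ⟨η, ρ, hη, hρ, hρm⟩ := hm.exists_isBoundedCoupling fun z => (hγ z).mono (hD z).le
  -- Translating the test function by `v` replaces `z` by `z + v` in its integral against `ν^z`,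
  -- which the mean ignores.
  have hinv : ρ.IsAddLeftInvariant := by
    refine ⟨fun v => ?_⟩
    have : IsFiniteMeasureOnCompacts (ρ.map (v + ·)) :=
      Measure.IsFiniteMeasureOnCompacts.map ρ (Homeomorph.addLeft v)
    refine ext_of_integral_eq_of_hasCompactSupport fun φ hc hs => ?_
    rw [integral_map (by fun_prop) hc.aestronglyMeasurable,
      (hρm (fun x => φ (v + x)) (by fun_prop) (hs.comp_homeomorph (Homeomorph.addLeft v))).2,
      (hρm φ hc hs).2, ← hm.map_comp_add_right _ (hρm φ hc hs).1 v]
    congr 1 with z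
    rw [integral_shiftMeasure ν z (by fun_prop), integral_shiftMeasure ν (z + v) hc]
    congr 1 with x
    congr 1
    abel
  have hvol := Measure.isAddLeftInvariant_eq_smul ρ volume
  -- A zero factor would give `ρ = 0`, hence `η = 0`, hence `ν = 0`.
  refine ⟨ρ.addHaarScalarFactor volume, pos_iff_ne_zero.2 fun h0 => hν ?_, ?_⟩
  · rw [h0, zero_smul] at hvol
    have hη0 : η = 0 := by
      rw [← Measure.map_eq_zero_iff measurable_snd.aemeasurable, hη.map_snd, hvol]
    rw [← hη.map_fst, hη0, Measure.map_zero]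
  · rw [← hvol]
    exact hη.tra_le.trans_lt ENNReal.coe_lt_top

theorem theorem1 {d : ℕ} (ν : Measure (EuclideanSpace ℝ (Fin d))) [IsLocallyFiniteMeasure ν]
    (hν : ν ≠ 0) :
    IsUniformlySpread ν ↔
      ∃ C : ℝ≥0, ∀ z : EuclideanSpace ℝ (Fin d), Tra ν (shiftMeasure ν z) < (C : ℝ≥0∞) :=
  ⟨IsUniformlySpread.exists_tra_shiftMeasure_lt,
    fun ⟨_, h⟩ => isUniformlySpread_of_tra_shiftMeasure_lt hν h⟩
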